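/- Let $n\ge 1$, let $\Gamma=\partial[0,1]^n\setminus(0,1]^n$, and write $a_+=\max(a,0)$. For $R:[0,1]^n\times\mathbb R\to\mathbb R$, a function $u\in \mathrm{USC}([0,1]^n)$ is a viscosity subsolution of $$(u_{x_1})_+\cdots(u_{x_n})_+=R(x,u)\ \text{ in }(0,1]^n,\qquad u=0\ \text{ on }\Gamma \qquad(*)$$ if $u\le 0$ on $\Gamma$ and, for every $x_0\in(0,1]^n$ and every $C^1$ function $\varphi$ such that $u-\varphi$ has a local maximum at $x_0$ relative to $(0,1]^n$, one has $\prod_i(\varphi_{x_i}(x_0))_+\le R(x_0,u(x_0))$. Viscosity supersolutions are defined analogously, with $u\in\mathrm{LSC}([0,1]^n)$, $u\ge0$ on $\Gamma$, local minima and $\ge$. A viscosity solution is both a sub- and a supersolution. Problem (P1) is $(*)$ with $R(x,z)=f(x)$, and problem (P2) is $(*)$ with $R(x,z)=z^{n-1}f(x)$. A function is nondecreasing if it is nondecreasing in each coordinate. Further, $[g]_{1;[0,1]^n}=\sup_{x\ne y}|g(x)-g(y)|/|x-y|$ and $\|g\|_{C^{0,1}([0,1]^n)}=\|g\|_{L^\infty([0,1]^n)}+[g]_{1;[0,1]^n}$.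 There is a constant $C>0$ depending only on $n$ such that the following holds. Let $f\ge0$ on $[0,1]^n$ with $f^{1/n}\in C^{0,1}([0,1]^n)$, let $u$ be the nondecreasing viscosity solution of (P1), and let $v=u^n/n^n$ on $[0,1]^n$. Then $v$ is the maximal viscosity solution of (P2), i.e. $v$ is a nondecreasing viscosity solution of (P2) and $z\le v$ on $[0,1]^n$ for every nonnegative viscosity subsolution $z$ of (P2). Moreover $v\in C^{0,1}([0,1]^n)$ and $$[v]_{1;[0,1]^n}\le C\,\big\|f^{\frac{n-1}{n}}\big\|_{L^\infty([0,1]^n)}\,\big\|f^{\frac1n}\big\|_{C^{0,1}([0,1]^n)},$$ where $f^{\frac{n-1}{n}}\equiv 1$ if $n=1$. -/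

import Mathlib

/-- The closed unit cube `[0,1]^n` in Euclidean space. -/
def unitCube (n : ℕ) : Set (EuclideanSpace ℝ (Fin n)) :=
  {x | ∀ i, 0 ≤ x i ∧ x i ≤ 1}

/-- The half-open unit cube `(0,1]^n`. -/
def halfOpenCube (n : ℕ) : Set (EuclideanSpace ℝ (Fin n)) :=
  {x | ∀ i, 0 < x i ∧ x i ≤ 1}

/-- The part `Γ = ∂[0,1]^n \ (0,1]^n` of the boundary of the unit cube, that is, the set of the
points of the cube at which at least one coordinate vanishes. -/
def lowerBoundary (n : ℕ) : Set (EuclideanSpace ℝ (Fin n)) :=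
  unitCube n \ halfOpenCube n

/-- The partial derivative `φ_{x_i}(x)`. -/
noncomputable def partialDeriv {n : ℕ} (φ : EuclideanSpace ℝ (Fin n) → ℝ) (i : Fin n)
    (x : EuclideanSpace ℝ (Fin n)) : ℝ :=
  fderiv ℝ φ x (EuclideanSpace.single i 1)

/-- The operator `(φ_{x_1})_+ ⋯ (φ_{x_n})_+` at the point `x`. -/
noncomputable def posPartialProd {n : ℕ} (φ : EuclideanSpace ℝ (Fin n) → ℝ)
    (x : EuclideanSpace ℝ (Fin n)) : ℝ :=
  ∏ i, max (partialDeriv φ i x) 0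

/-- `u ∈ USC([0,1]^n)` is a viscosity subsolution of
`(u_{x_1})_+ ⋯ (u_{x_n})_+ = R(x, u)` in `(0,1]^n`, `u = 0` on `Γ`.
Local maxima are relative to `(0,1]^n`, so that the faces `{x_i = 1}` belong to the domain of
the equation. -/
structure IsViscositySubsolution {n : ℕ} (R : EuclideanSpace ℝ (Fin n) → ℝ → ℝ)
    (u : EuclideanSpace ℝ (Fin n) → ℝ) : Prop where
  usc : UpperSemicontinuousOn u (unitCube n)
  boundary : ∀ x ∈ lowerBoundary n, u x ≤ 0
  test : ∀ φ : EuclideanSpace ℝ (Fin n) → ℝ, ContDiff ℝ 1 φ → ∀ x ∈ halfOpenCube n,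
    IsLocalMaxOn (fun y => u y - φ y) (halfOpenCube n) x → posPartialProd φ x ≤ R x (u x)

/-- `u ∈ LSC([0,1]^n)` is a viscosity supersolution of
`(u_{x_1})_+ ⋯ (u_{x_n})_+ = R(x, u)` in `(0,1]^n`, `u = 0` on `Γ`. -/
structure IsViscositySupersolution {n : ℕ} (R : EuclideanSpace ℝ (Fin n) → ℝ → ℝ)
    (u : EuclideanSpace ℝ (Fin n) → ℝ) : Prop where
  lsc : LowerSemicontinuousOn u (unitCube n)
  boundary : ∀ x ∈ lowerBoundary n, 0 ≤ u x
  test : ∀ φ : EuclideanSpace ℝ (Fin n) → ℝ, ContDiff ℝ 1 φ → ∀ x ∈ halfOpenCube n,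
    IsLocalMinOn (fun y => u y - φ y) (halfOpenCube n) x → R x (u x) ≤ posPartialProd φ x

/-- A viscosity solution is both a viscosity sub- and a viscosity supersolution; in particular it
is continuous on `[0,1]^n` and vanishes on `Γ`. -/
def IsViscositySolution {n : ℕ} (R : EuclideanSpace ℝ (Fin n) → ℝ → ℝ)
    (u : EuclideanSpace ℝ (Fin n) → ℝ) : Prop :=
  IsViscositySubsolution R u ∧ IsViscositySupersolution R u

/-- `u` is nondecreasing in each coordinate on `[0,1]^n`. -/
def NondecreasingOnCube {n : ℕ} (u : EuclideanSpace ℝ (Fin n) → ℝ) : Prop :=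
  ∀ x ∈ unitCube n, ∀ y ∈ unitCube n, (∀ i, x i ≤ y i) → u x ≤ u y

/-- The right-hand side `f` of the equation `(u_{x_1})_+ ⋯ (u_{x_n})_+ = f`. -/
def rhsOriginal {n : ℕ} (f : EuclideanSpace ℝ (Fin n) → ℝ) : EuclideanSpace ℝ (Fin n) → ℝ → ℝ :=
  fun x _ => f x

/-- The right-hand side `v^{n-1} f` of the equation `(v_{x_1})_+ ⋯ (v_{x_n})_+ = v^{n-1} f`
(used for `1 ≤ n` only). -/
def rhsTransformed {n : ℕ} (f : EuclideanSpace ℝ (Fin n) → ℝ) : EuclideanSpace ℝ (Fin n) → ℝ → ℝ :=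
  fun x z => z ^ (n - 1) * f x

/-- `g ∈ C^{0,1}(S)`. For compact `S`, as for the cube, boundedness of `g` is automatic. -/
def IsLipschitzOn {n : ℕ} (g : EuclideanSpace ℝ (Fin n) → ℝ)
    (S : Set (EuclideanSpace ℝ (Fin n))) : Prop :=
  ∃ K : NNReal, LipschitzOnWith K g S

/-- The seminorm `[g]_{1;S} = sup_{x ≠ y} |g(x) - g(y)| / |x - y|`, with the Euclidean norm
(meaningful for `g ∈ C^{0,1}(S)`). -/
noncomputable def lipSeminorm {n : ℕ} (g : EuclideanSpace ℝ (Fin n) → ℝ)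
    (S : Set (EuclideanSpace ℝ (Fin n))) : ℝ :=
  sSup {q : ℝ | ∃ x ∈ S, ∃ y ∈ S, x ≠ y ∧ q = |g x - g y| / ‖x - y‖}

/-- The supremum norm over `S` (meaningful for `g` bounded on `S`); for a continuous function on
the cube it is the `L^∞` norm. -/
noncomputable def supNormOn {n : ℕ} (g : EuclideanSpace ℝ (Fin n) → ℝ)
    (S : Set (EuclideanSpace ℝ (Fin n))) : ℝ :=
  sSup ((fun x => |g x|) '' S)

/-- The norm `‖g‖_{C^{0,1}(S)} = ‖g‖_{L^∞(S)} + [g]_{1;S}`. -/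
noncomputable def lipNorm {n : ℕ} (g : EuclideanSpace ℝ (Fin n) → ℝ)
    (S : Set (EuclideanSpace ℝ (Fin n))) : ℝ :=
  supNormOn g S + lipSeminorm g S

open Filter Topology

/-! Everything rests on one comparison principle, `IsViscositySubsolution.le_diagScale`. Let σ be
the diagonal map with entries l_i in (0,1], let c^n ∏ l_i = 1, and let u be a nondecreasing
supersolution with right-hand side g^n. Formally c u(σx) has right-hand side g(σx)^n. The function n
(∏ x_i)^{1/n} solves the equation with right-hand side 1. Since the geometric mean is superadditive,
adding k times this function, evaluated at σx, turns the right-hand side into at least (g(σx) +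
k/c)^n. Doubling of variables makes this rigorous, with the scaling placed in the penalty ∑ (l_i x_i
- y_i)^2.

With σ the identity, this is the usual comparison principle; against the zero supersolution it gives
u ≤ M n (∏ x_i)^{1/n} for M = max f^{1/n}. For y ≤ x with all y_i > 0, take l_i = y_i/x_i: then σx =
y, and u(x) is bounded by u(y) up to terms in c - 1 and D = ∑ (x_i - y_i)/x_i, which are singular at
Γ. Passing to (u/n)^n brings in a factor u^{n-1}, and the bound on u supplies exactly the power of ∏
x_i that absorbs these singularities.

The substitution v = (u/n)^n exchanges the two equations at points of positivity, because the
operator is homogeneous of degree n; zeros are treated by hand. Maximality follows by comparing n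
z^{1/n} with u. -/

/-! ### Calculus of the operator and localisation of test functions. -/

theorem partialDeriv_eq_of_hasDerivAt {n : ℕ} {φ : EuclideanSpace ℝ (Fin n) → ℝ}
    {x : EuclideanSpace ℝ (Fin n)} {i : Fin n} {d : ℝ} (hφ : DifferentiableAt ℝ φ x)
    (h : HasDerivAt (fun t : ℝ => φ (x + t • EuclideanSpace.single i 1)) d 0) :
    partialDeriv φ i x = d :=
  HasDerivAt.unique (hφ.hasFDerivAt.hasLineDerivAt (EuclideanSpace.single i 1)) h

theorem partialDeriv_congr {n : ℕ} {φ ψ : EuclideanSpace ℝ (Fin n) → ℝ}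
    {x : EuclideanSpace ℝ (Fin n)} (h : φ =ᶠ[𝓝 x] ψ) (i : Fin n) :
    partialDeriv φ i x = partialDeriv ψ i x := by
  unfold partialDeriv
  rw [h.fderiv_eq]

theorem posPartialProd_congr {n : ℕ} {φ ψ : EuclideanSpace ℝ (Fin n) → ℝ}
    {x : EuclideanSpace ℝ (Fin n)} (h : φ =ᶠ[𝓝 x] ψ) :
    posPartialProd φ x = posPartialProd ψ x :=
  Finset.prod_congr rfl fun i _ => by rw [partialDeriv_congr h i]

theorem posPartialProd_nonneg {n : ℕ} (φ : EuclideanSpace ℝ (Fin n) → ℝ)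
    (x : EuclideanSpace ℝ (Fin n)) : 0 ≤ posPartialProd φ x :=
  Finset.prod_nonneg fun _ _ => le_max_right _ _

theorem posPartialProd_eq_zero {n : ℕ} {φ : EuclideanSpace ℝ (Fin n) → ℝ}
    {x : EuclideanSpace ℝ (Fin n)} (i : Fin n) (h : partialDeriv φ i x ≤ 0) :
    posPartialProd φ x = 0 :=
  Finset.prod_eq_zero (Finset.mem_univ i) (max_eq_right h)

/-- Each of the n factors scales by d, and d ≥ 0 commutes with the positive part. This drives the
change of unknown between the two equations. -/
theorem posPartialProd_comp {n : ℕ} {φ : EuclideanSpace ℝ (Fin n) → ℝ}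
    {x : EuclideanSpace ℝ (Fin n)} {h : ℝ → ℝ} {d : ℝ} (hφ : DifferentiableAt ℝ φ x)
    (hh : HasDerivAt h d (φ x)) (hd : 0 ≤ d) :
    posPartialProd (fun y => h (φ y)) x = d ^ n * posPartialProd φ x := by
  have key : ∀ i, max (partialDeriv (fun y => h (φ y)) i x) 0 = d * max (partialDeriv φ i x) 0 := by
    intro i
    have : partialDeriv (fun y => h (φ y)) i x = d * partialDeriv φ i x := by
      have h1 := (hh.comp_hasFDerivAt x hφ.hasFDerivAt).fderiv
      unfold partialDeriv
      rw [show (fun y => h (φ y)) = h ∘ φ from rfl, h1]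
      simp
    rw [this, mul_max_of_nonneg _ _ hd, mul_zero]
  simp only [posPartialProd, key, Finset.prod_mul_distrib, Finset.prod_const, Finset.card_univ,
    Fintype.card_fin]

/-- A function that is `C^1` at a point agrees near that point with a globally `C^1` function. -/
theorem exists_contDiff_eventuallyEq {n : ℕ} {φ : EuclideanSpace ℝ (Fin n) → ℝ}
    {x : EuclideanSpace ℝ (Fin n)} (hφ : ContDiffAt ℝ 1 φ x) :
    ∃ ψ : EuclideanSpace ℝ (Fin n) → ℝ, ContDiff ℝ 1 ψ ∧ ψ =ᶠ[𝓝 x] φ := by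
  obtain ⟨r, hr, hball⟩ := Metric.eventually_nhds_iff_ball.1 (hφ.eventually (by simp))
  let χ : ContDiffBump x := ⟨r / 4, r / 2, by positivity, by linarith⟩
  refine ⟨fun y => χ y * φ y, contDiff_iff_contDiffAt.2 fun y => ?_, ?_⟩
  · by_cases hy : y ∈ Metric.ball x r
    · exact (χ.contDiff.contDiffAt).mul (hball y hy)
    · have hy' : y ∉ tsupport χ := by
        rw [χ.tsupport_eq]
        intro h
        exact hy (Metric.closedBall_subset_ball (by change r / 2 < r; linarith) h)
      have h0 := notMem_tsupport_iff_eventuallyEq.1 hy'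
      refine (contDiffAt_const (c := (0 : ℝ))).congr_of_eventuallyEq ?_
      filter_upwards [h0] with z hz
      simp [hz]
  · filter_upwards [χ.eventuallyEq_one] with z hz
    simp [hz]

/-- The test functions used below contain n-th roots and are `C^1` only near the point; since the
viscosity condition is local, a cut-off loses nothing. -/
theorem IsViscositySubsolution.test_of_contDiffAt {n : ℕ} {R : EuclideanSpace ℝ (Fin n) → ℝ → ℝ}
    {u φ : EuclideanSpace ℝ (Fin n) → ℝ} (hu : IsViscositySubsolution R u)
    {x : EuclideanSpace ℝ (Fin n)} (hφ : ContDiffAt ℝ 1 φ x) (hx : x ∈ halfOpenCube n)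
    (hmax : ∀ᶠ y in 𝓝[halfOpenCube n] x, u y - φ y ≤ u x - φ x) :
    posPartialProd φ x ≤ R x (u x) := by
  obtain ⟨ψ, hψ, heq⟩ := exists_contDiff_eventuallyEq hφ
  rw [← posPartialProd_congr heq]
  refine hu.test ψ hψ x hx ?_
  filter_upwards [hmax, mem_nhdsWithin_of_mem_nhds heq] with y hy hy'
  have := heq.self_of_nhds
  rw [hy', this]
  exact hy

theorem IsViscositySupersolution.test_of_contDiffAt {n : ℕ}
    {R : EuclideanSpace ℝ (Fin n) → ℝ → ℝ}
    {u φ : EuclideanSpace ℝ (Fin n) → ℝ} (hu : IsViscositySupersolution R u)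
    {x : EuclideanSpace ℝ (Fin n)} (hφ : ContDiffAt ℝ 1 φ x) (hx : x ∈ halfOpenCube n)
    (hmin : ∀ᶠ y in 𝓝[halfOpenCube n] x, u x - φ x ≤ u y - φ y) :
    R x (u x) ≤ posPartialProd φ x := by
  obtain ⟨ψ, hψ, heq⟩ := exists_contDiff_eventuallyEq hφ
  rw [← posPartialProd_congr heq]
  refine hu.test ψ hψ x hx ?_
  filter_upwards [hmin, mem_nhdsWithin_of_mem_nhds heq] with y hy hy'
  have := heq.self_of_nhds
  rw [hy', this]
  exact hy

/-! ### Geometry of the cube. -/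

theorem halfOpenCube_subset_unitCube (n : ℕ) : halfOpenCube n ⊆ unitCube n :=
  fun _ hx i => ⟨(hx i).1.le, (hx i).2⟩

theorem mem_halfOpenCube_of_mem_unitCube {n : ℕ} {x : EuclideanSpace ℝ (Fin n)}
    (hx : x ∈ unitCube n) (h : ∀ i, 0 < x i) : x ∈ halfOpenCube n :=
  fun i => ⟨h i, (hx i).2⟩

theorem mem_lowerBoundary_of_eq_zero {n : ℕ} {x : EuclideanSpace ℝ (Fin n)}
    (hx : x ∈ unitCube n) (i : Fin n) (h : x i = 0) : x ∈ lowerBoundary n :=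
  ⟨hx, fun hx' => (hx' i).1.ne' h⟩

theorem isCompact_unitCube (n : ℕ) : IsCompact (unitCube n) := by
  have h : unitCube n = (EuclideanSpace.equiv (Fin n) ℝ).toHomeomorph ⁻¹'
      (Set.Icc (0 : Fin n → ℝ) 1) := by
    ext x
    simp [unitCube, Set.mem_Icc, Pi.le_def, forall_and]
  rw [h]
  exact (Homeomorph.isCompact_preimage _).2 isCompact_Icc

/-- If `φ` does not exceed `φ x` at the points near `x` that lie below `x`, its partial derivatives
at `x` are nonnegative. -/
theorem partialDeriv_nonneg_of_eventually {n : ℕ} {φ : EuclideanSpace ℝ (Fin n) → ℝ}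
    {x : EuclideanSpace ℝ (Fin n)} (hφ : DifferentiableAt ℝ φ x) (hx : x ∈ halfOpenCube n)
    (i : Fin n)
    (h : ∀ᶠ y in 𝓝[halfOpenCube n] x, (∀ j, y j ≤ x j) → φ y ≤ φ x) :
    0 ≤ partialDeriv φ i x := by
  have hd := hφ.hasFDerivAt.hasLineDerivAt (EuclideanSpace.single i (1 : ℝ))
  have hd' : HasDerivAt (fun t : ℝ => φ (x + t • EuclideanSpace.single i 1))
    (partialDeriv φ i x) 0 := hd
  have hslope := (hasDerivAt_iff_tendsto_slope.1 hd').mono_left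
    (nhdsWithin_mono (0 : ℝ) (show Set.Iio (0 : ℝ) ⊆ {0}ᶜ from fun t ht => ne_of_lt ht))
  -- Only t < 0 is used: decreasing a coordinate slightly stays in the half-open cube even on the
  -- faces where it equals 1.
  have hline : Tendsto (fun t : ℝ => x + t • EuclideanSpace.single i (1 : ℝ)) (𝓝[<] 0)
      (𝓝[halfOpenCube n] x) := by
    refine tendsto_nhdsWithin_iff.2 ⟨?_, ?_⟩
    · have : Continuous (fun t : ℝ => x + t • EuclideanSpace.single i (1 : ℝ)) := by fun_prop
      have := this.tendsto 0
      simp only [zero_smul, add_zero] at this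
      exact this.mono_left nhdsWithin_le_nhds
    · have h1 : ∀ᶠ t : ℝ in 𝓝[<] 0, -(x i) < t :=
        mem_nhdsWithin_of_mem_nhds (lt_mem_nhds (by linarith [(hx i).1]))
      filter_upwards [h1, self_mem_nhdsWithin] with t ht ht0 j
      rcases eq_or_ne j i with rfl | hj
      · have := hx j
        simp only [PiLp.add_apply, PiLp.smul_apply, PiLp.single_apply, if_true,
          smul_eq_mul, mul_one]
        constructor <;> linarith [Set.mem_Iio.1 ht0]
      · simpa [hj] using hx j
  refine ge_of_tendsto hslope ?_
  filter_upwards [hline.eventually h, self_mem_nhdsWithin] with t ht ht0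
  have ht0' : t < 0 := ht0
  have h2 : φ (x + t • EuclideanSpace.single i 1) ≤ φ x := by
    refine ht fun j => ?_
    rcases eq_or_ne j i with rfl | hj
    · simp [ht0'.le]
    · simp [hj]
  rw [slope_def_field]
  simp only [zero_smul, add_zero, sub_zero]
  exact div_nonneg_of_nonpos (by linarith) ht0'.le

/-! ### The geometric mean and product inequalities. -/

/-- The geometric mean of the coordinates. -/
noncomputable def geomMean {n : ℕ} (x : EuclideanSpace ℝ (Fin n)) : ℝ :=
  (∏ i, x i) ^ (1 / (n : ℝ))

theorem geomMean_pow {n : ℕ} (hn : 1 ≤ n) {x : EuclideanSpace ℝ (Fin n)} (hx : ∀ i, 0 ≤ x i) :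
    geomMean x ^ n = ∏ i, x i := by
  rw [geomMean, one_div, Real.rpow_inv_natCast_pow (Finset.prod_nonneg fun i _ => hx i) (by omega)]

theorem geomMean_nonneg {n : ℕ} {x : EuclideanSpace ℝ (Fin n)} (hx : ∀ i, 0 ≤ x i) :
    0 ≤ geomMean x :=
  Real.rpow_nonneg (Finset.prod_nonneg fun i _ => hx i) _

theorem geomMean_pos {n : ℕ} {x : EuclideanSpace ℝ (Fin n)} (hx : ∀ i, 0 < x i) :
    0 < geomMean x :=
  Real.rpow_pos_of_pos (Finset.prod_pos fun i _ => hx i) _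

theorem continuous_geomMean (n : ℕ) : Continuous (geomMean (n := n)) :=
  Continuous.rpow_const (by fun_prop) fun _ => Or.inr (by positivity)

theorem contDiffAt_geomMean {n : ℕ} {x : EuclideanSpace ℝ (Fin n)} (hx : ∀ i, 0 < x i) :
    ContDiffAt ℝ 1 geomMean x := by
  refine ContDiffAt.rpow_const_of_ne ?_ (Finset.prod_pos fun i _ => hx i).ne'
  fun_prop

/-- Consequently k n `geomMean` has partial derivatives k `geomMean x` / x_i, whose product is k^n:
it is the explicit solution for a constant right-hand side. -/
theorem partialDeriv_geomMean {n : ℕ} {x : EuclideanSpace ℝ (Fin n)}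
    (hx : ∀ i, 0 < x i) (i : Fin n) :
    partialDeriv geomMean i x = geomMean x / (n * x i) := by
  have hn : (n : ℝ) ≠ 0 := by
    have := i.pos
    positivity
  refine partialDeriv_eq_of_hasDerivAt ((contDiffAt_geomMean hx).differentiableAt (by simp)) ?_
  have hP : 0 < ∏ j, x j := Finset.prod_pos fun j _ => hx j
  set Q := ∏ j ∈ Finset.univ.erase i, x j with hQ
  have hQP : (x i) * Q = ∏ j, x j := Finset.mul_prod_erase _ _ (Finset.mem_univ i)
  have h1 : (fun t : ℝ => geomMean (x + t • EuclideanSpace.single i 1)) =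
      fun t => ((x i + t) * Q) ^ (1 / (n : ℝ)) := by
    funext t
    rw [geomMean, ← Finset.mul_prod_erase _ _ (Finset.mem_univ i), hQ]
    congr 2
    · simp
    · refine Finset.prod_congr rfl fun j hj => ?_
      simp [Finset.ne_of_mem_erase hj]
  rw [h1]
  have h2 : HasDerivAt (fun t : ℝ => (x i + t) * Q) (1 * Q) 0 :=
    ((hasDerivAt_id (0 : ℝ)).const_add (x i)).mul_const Q
  have h3 := h2.rpow_const (p := 1 / (n : ℝ)) (Or.inl (by simp only [add_zero, hQP]; exact hP.ne'))
  convert h3 using 1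
  rw [add_zero, hQP, Real.rpow_sub_one hP.ne', geomMean, ← hQP]
  have := (hx i).ne'
  have hQ0 : Q ≠ 0 := by
    rintro h
    rw [h, mul_zero] at hQP
    exact hP.ne hQP
  field_simp

/-- Superadditivity of the geometric mean, in the form in which one summand has geometric mean
`k`. -/
theorem pow_add_le_prod_add {n : ℕ} (hn : 1 ≤ n) {q r : Fin n → ℝ} (hq : ∀ i, 0 ≤ q i)
    (hr : ∀ i, 0 < r i) {a k : ℝ} (ha : 0 ≤ a) (hk : 0 ≤ k) (haq : a ^ n ≤ ∏ i, q i)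
    (hkr : k ^ n ≤ ∏ i, r i) : (a + k) ^ n ≤ ∏ i, (q i + r i) := by
  have hn0 : (n : ℝ) ≠ 0 := by positivity
  have hs : ∀ i, 0 < q i + r i := fun i => add_pos_of_nonneg_of_pos (hq i) (hr i)
  have hS : 0 < ∏ i, (q i + r i) := Finset.prod_pos fun i _ => hs i
  set s := (∏ i, (q i + r i)) ^ ((n : ℝ)⁻¹) with hsdef
  have hs0 : 0 < s := Real.rpow_pos_of_pos hS _
  have hsn : s ^ n = ∏ i, (q i + r i) := Real.rpow_inv_natCast_pow hS.le (by omega)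
  -- AM-GM for the ratios z_i/(q_i + r_i). For z = q and z = r these ratios add up to 1 in each
  -- coordinate, so the two bounds sum to s.
  have amgm : ∀ (b : ℝ) (z : Fin n → ℝ), 0 ≤ b → (∀ i, 0 ≤ z i) → b ^ n ≤ ∏ i, z i →
      b ≤ s * ∑ i, (n : ℝ)⁻¹ * (z i / (q i + r i)) := by
    intro b z hb hz hbz
    have h1 := Real.geom_mean_le_arith_mean_weighted Finset.univ (fun _ : Fin n => (n : ℝ)⁻¹)
      (fun i => z i / (q i + r i)) (fun _ _ => by positivity) (by simp [hn0])
      (fun i _ => div_nonneg (hz i) (hs i).le)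
    rw [Real.finsetProd_rpow _ _ (fun i _ => div_nonneg (hz i) (hs i).le), Finset.prod_div_distrib,
      Real.div_rpow (Finset.prod_nonneg fun i _ => hz i) hS.le, ← hsdef, div_le_iff₀' hs0] at h1
    refine le_trans ?_ h1
    rw [← Real.pow_rpow_inv_natCast hb (show n ≠ 0 by omega)]
    exact Real.rpow_le_rpow (by positivity) hbz (by positivity)
  have h1 := amgm a q ha hq haq
  have h2 := amgm k r hk (fun i => (hr i).le) hkr
  have h3 : s * ∑ i, (n : ℝ)⁻¹ * (q i / (q i + r i)) + s * ∑ i, (n : ℝ)⁻¹ * (r i / (q i + r i))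
      = s := by
    rw [← mul_add, ← Finset.sum_add_distrib]
    have : ∀ i, (n : ℝ)⁻¹ * (q i / (q i + r i)) + (n : ℝ)⁻¹ * (r i / (q i + r i)) = (n : ℝ)⁻¹ := by
      intro i
      rw [← mul_add, ← add_div, div_self (hs i).ne', mul_one]
    simp [this, hn0]
  rw [← hsn]
  exact pow_le_pow_left₀ (by positivity) (by linarith) n

/-- Change one factor at a time; the other factors are at most 1. -/
theorem prod_sub_prod_le_sum {ι : Type*} (s : Finset ι) {x y : ι → ℝ}
    (hy : ∀ i ∈ s, 0 ≤ y i) (hyx : ∀ i ∈ s, y i ≤ x i) (hx : ∀ i ∈ s, x i ≤ 1) :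
    ∏ i ∈ s, x i - ∏ i ∈ s, y i ≤ ∑ i ∈ s, (x i - y i) := by
  classical
  induction s using Finset.induction_on with
  | empty => simp
  | insert a s ha ih =>
    rw [Finset.prod_insert ha, Finset.prod_insert ha, Finset.sum_insert ha]
    have ih' := ih (fun i hi => hy i (Finset.mem_insert_of_mem hi))
      (fun i hi => hyx i (Finset.mem_insert_of_mem hi))
      (fun i hi => hx i (Finset.mem_insert_of_mem hi))
    have hY0 : 0 ≤ ∏ i ∈ s, y i :=
      Finset.prod_nonneg fun i hi => hy i (Finset.mem_insert_of_mem hi)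
    have hYX : ∏ i ∈ s, y i ≤ ∏ i ∈ s, x i :=
      Finset.prod_le_prod (fun i hi => hy i (Finset.mem_insert_of_mem hi))
        fun i hi => hyx i (Finset.mem_insert_of_mem hi)
    have hX1 : ∏ i ∈ s, x i ≤ 1 :=
      Finset.prod_le_one (fun i hi => (hy i (Finset.mem_insert_of_mem hi)).trans
        (hyx i (Finset.mem_insert_of_mem hi))) fun i hi => hx i (Finset.mem_insert_of_mem hi)
    have h1 := hy a (Finset.mem_insert_self a s)
    have h2 := hyx a (Finset.mem_insert_self a s)
    have h3 := hx a (Finset.mem_insert_self a s)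
    nlinarith [mul_nonneg (sub_nonneg.2 h2) (sub_nonneg.2 (hYX.trans hX1)),
      mul_nonneg (sub_nonneg.2 h3) (sub_nonneg.2 hYX)]

/-! ### Comparison under diagonal scalings, by doubling of variables. -/

/-- The diagonal map with entries `l i`. -/
noncomputable def diagScale {n : ℕ} (l : Fin n → ℝ) (x : EuclideanSpace ℝ (Fin n)) :
    EuclideanSpace ℝ (Fin n) :=
  WithLp.toLp 2 fun i => l i * x i

@[simp]
theorem diagScale_apply {n : ℕ} (l : Fin n → ℝ) (x : EuclideanSpace ℝ (Fin n)) (i : Fin n) :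
    diagScale l x i = l i * x i := rfl

theorem diagScale_mem_unitCube {n : ℕ} {l : Fin n → ℝ} (hl : ∀ i, 0 < l i ∧ l i ≤ 1)
    {x : EuclideanSpace ℝ (Fin n)} (hx : x ∈ unitCube n) : diagScale l x ∈ unitCube n :=
  fun i => ⟨mul_nonneg (hl i).1.le (hx i).1, mul_le_one₀ (hl i).2 (hx i).1 (hx i).2⟩

theorem zero_mem_lowerBoundary {n : ℕ} (hn : 1 ≤ n) :
    (0 : EuclideanSpace ℝ (Fin n)) ∈ lowerBoundary n :=
  mem_lowerBoundary_of_eq_zero (fun i => by simp) ⟨0, hn⟩ (by simp)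

theorem IsViscositySupersolution.nonneg_of_nondecreasing {n : ℕ} (hn : 1 ≤ n)
    {R : EuclideanSpace ℝ (Fin n) → ℝ → ℝ} {u : EuclideanSpace ℝ (Fin n) → ℝ}
    (hu : IsViscositySupersolution R u) (hmono : NondecreasingOnCube u)
    {x : EuclideanSpace ℝ (Fin n)} (hx : x ∈ unitCube n) : 0 ≤ u x :=
  (hu.boundary 0 (zero_mem_lowerBoundary hn)).trans
    (hmono 0 (zero_mem_lowerBoundary hn).1 x hx fun i => by simpa using (hx i).1)

theorem partialDeriv_sum_sq_left {n : ℕ} (l : Fin n → ℝ) (N : ℝ) (x y : EuclideanSpace ℝ (Fin n))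
    (i : Fin n) :
    partialDeriv (fun z => N / 2 * ∑ j, (l j * z j - y j) ^ 2) i x =
      l i * (N * (l i * x i - y i)) := by
  refine partialDeriv_eq_of_hasDerivAt
    ((by fun_prop : Differentiable ℝ (fun z : EuclideanSpace ℝ (Fin n) =>
      N / 2 * ∑ j, (l j * z j - y j) ^ 2)) x) ?_
  have h : ∀ j ∈ Finset.univ, HasDerivAt (fun t : ℝ =>
      (l j * (x + t • EuclideanSpace.single i (1 : ℝ)) j - y j) ^ 2)
      (if j = i then 2 * (l i * x i - y i) * l i else 0) 0 := by
    intro j _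
    split_ifs with hj
    · subst hj
      have : HasDerivAt (fun t : ℝ => l j * (x j + t) - y j) (l j * 1) 0 :=
        (((hasDerivAt_id (0 : ℝ)).const_add (x j)).const_mul (l j)).sub_const _
      simpa using this.fun_pow 2
    · simpa [hj] using hasDerivAt_const (0 : ℝ) ((l j * x j - y j) ^ 2)
  have := (HasDerivAt.fun_sum h).const_mul (N / 2)
  refine this.congr_deriv ?_
  simp
  ring

theorem partialDeriv_sum_sq_right {n : ℕ} (a : Fin n → ℝ) (N : ℝ) (y : EuclideanSpace ℝ (Fin n))
    (i : Fin n) :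
    partialDeriv (fun z => N / 2 * ∑ j, (a j - z j) ^ 2) i y = -(N * (a i - y i)) := by
  have h := partialDeriv_sum_sq_left (fun _ => 1) N y (WithLp.toLp 2 a) i
  have h2 : (fun z : EuclideanSpace ℝ (Fin n) => N / 2 * ∑ j, (a j - z j) ^ 2) =
      fun z => N / 2 * ∑ j, (1 * z j - (WithLp.toLp 2 a : EuclideanSpace ℝ (Fin n)) j) ^ 2 := by
    funext z
    congr 1
    exact Finset.sum_congr rfl fun j _ => by simp only [one_mul]; ring
  rw [h2, h]
  simp only [one_mul]
  ring

/-- The one-point inequality behind the comparison theorem: at a maximum of the doubled function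
the two equations bound `g₂ y + k / c` by `g₁ x`. -/
theorem le_of_isMaxOn_doubled {n : ℕ} (hn : 1 ≤ n)
    {f₁ f₂ w u : EuclideanSpace ℝ (Fin n) → ℝ} {a₁ a₂ : ℝ} {l : Fin n → ℝ} {c k N : ℝ}
    (hw : IsViscositySubsolution (rhsOriginal f₁) w)
    (hu : IsViscositySupersolution (rhsOriginal f₂) u) (hmono : NondecreasingOnCube u)
    (hl : ∀ i, 0 < l i) (hc : 0 < c) (hcl : c ^ n * ∏ i, l i = 1) (hk : 0 < k)
    {x y : EuclideanSpace ℝ (Fin n)} (hx : x ∈ halfOpenCube n) (hy : y ∈ halfOpenCube n)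
    (hmax : ∀ x' ∈ halfOpenCube n, ∀ y' ∈ halfOpenCube n,
      w x' - c * u y' - k * (n * geomMean y') - N / 2 * ∑ i, (l i * x' i - y' i) ^ 2 ≤
        w x - c * u y - k * (n * geomMean y) - N / 2 * ∑ i, (l i * x i - y i) ^ 2)
    (ha₁ : 0 ≤ a₁) (ha₂ : 0 ≤ a₂) (hf₁ : f₁ x = a₁ ^ n) (hf₂ : f₂ y = a₂ ^ n) :
    c * a₂ + k ≤ c * a₁ := by
  have hn0 : (n : ℝ) ≠ 0 := by positivity
  -- `p` is the gradient of the penalty in the scaled variable, and `r` below is the gradient of k n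
  -- `geomMean` at y. The supersolution is thus tested with gradient (p - r)/c.
  set p : Fin n → ℝ := fun i => N * (l i * x i - y i) with hp
  set r : Fin n → ℝ := fun i => k * (geomMean y / y i) with hr
  have hypos : ∀ i, 0 < y i := fun i => (hy i).1
  have hrpos : ∀ i, 0 < r i := fun i => mul_pos hk (div_pos (geomMean_pos hypos) (hypos i))
  have hrprod : ∏ i, r i = k ^ n := by
    simp only [hr, Finset.prod_mul_distrib, Finset.prod_div_distrib, Finset.prod_const,
      Finset.card_univ, Fintype.card_fin]
    rw [geomMean_pow hn fun i => (hypos i).le, div_self (Finset.prod_pos fun i _ => hypos i).ne',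
      mul_one]
  -- the equation for `w` at `x`
  have h1 : (∏ i, l i) * ∏ i, max (p i) 0 ≤ a₁ ^ n := by
    have := hw.test_of_contDiffAt (φ := fun z => N / 2 * ∑ j, (l j * z j - y j) ^ 2) (x := x)
      (by fun_prop) hx (by
        filter_upwards [self_mem_nhdsWithin] with z hz
        have := hmax z hz y hy
        linarith)
    simp only [posPartialProd, partialDeriv_sum_sq_left, rhsOriginal, hf₁] at this
    rw [← Finset.prod_mul_distrib]
    refine le_of_eq_of_le (Finset.prod_congr rfl fun i _ => ?_) this
    rw [mul_max_of_nonneg _ _ (hl i).le, mul_zero]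
  -- the equation for `u` at `y`
  set φ : EuclideanSpace ℝ (Fin n) → ℝ := fun z =>
    (-(1 / c)) * (k * (n * geomMean z) + N / 2 * ∑ j, (l j * x j - z j) ^ 2) with hφ
  have hgm := contDiffAt_geomMean hypos
  have hφc : ContDiffAt ℝ 1 φ y := by
    refine contDiffAt_const.mul ((contDiffAt_const.mul (contDiffAt_const.mul hgm)).add ?_)
    fun_prop
  have hφd : ∀ i, partialDeriv φ i y = (1 / c) * (p i - r i) := by
    intro i
    have hgd := hgm.differentiableAt (by simp)
    have hsd : DifferentiableAt ℝ (fun z : EuclideanSpace ℝ (Fin n) =>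
      N / 2 * ∑ j, (l j * x j - z j) ^ 2) y := by fun_prop
    have e1 := partialDeriv_geomMean hypos i
    have e2 := partialDeriv_sum_sq_right (fun j => l j * x j) N y i
    unfold partialDeriv at e1 e2 ⊢
    rw [hφ, (((hgd.hasFDerivAt.const_mul (n : ℝ)).const_mul k).fun_add
      hsd.hasFDerivAt).const_mul (-(1 / c)) |>.fderiv]
    simp only [smul_apply, add_apply, smul_eq_mul, e1, e2]
    have := (hypos i).ne'
    simp only [hp, hr]
    field_simp
    ring
  have hmin : ∀ᶠ z in 𝓝[halfOpenCube n] y, u y - φ y ≤ u z - φ z := by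
    filter_upwards [self_mem_nhdsWithin] with z hz
    have h := hmax x hx z hz
    have e : ∀ z, u z - φ z = (1 / c) *
        (c * u z + k * (n * geomMean z) + N / 2 * ∑ j, (l j * x j - z j) ^ 2) := by
      intro z
      simp only [hφ]
      field_simp
      ring
    rw [e, e]
    exact mul_le_mul_of_nonneg_left (by linarith) (by positivity)
  -- Monotonicity of u enters here: a function touching u from below at y does not exceed its value
  -- at y at nearby points below y. Hence the positive parts can be dropped and superadditivity
  -- applies.
  have hq : ∀ i, 0 ≤ p i - r i := by
    intro i
    have h0 : 0 ≤ partialDeriv φ i y := by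
      refine partialDeriv_nonneg_of_eventually (hφc.differentiableAt (by simp)) hy i ?_
      filter_upwards [hmin, self_mem_nhdsWithin] with z hz hz' hle
      have := hmono z (halfOpenCube_subset_unitCube n hz') y (halfOpenCube_subset_unitCube n hy) hle
      linarith
    rw [hφd] at h0
    exact (mul_nonneg_iff_of_pos_left (by positivity)).1 h0
  have h2 : (c * a₂) ^ n ≤ ∏ i, (p i - r i) := by
    have := hu.test_of_contDiffAt hφc hy hmin
    simp only [posPartialProd, hφd, rhsOriginal, hf₂] at this
    rw [Finset.prod_congr rfl fun i _ => max_eq_left (mul_nonneg (by positivity) (hq i)),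
      Finset.prod_mul_distrib] at this
    simp only [Finset.prod_const, Finset.card_univ, Fintype.card_fin] at this
    calc (c * a₂) ^ n = c ^ n * a₂ ^ n := mul_pow _ _ _
      _ ≤ c ^ n * ((1 / c) ^ n * ∏ i, (p i - r i)) := by gcongr
      _ = ∏ i, (p i - r i) := by
        rw [← mul_assoc, ← mul_pow, mul_one_div_cancel hc.ne', one_pow, one_mul]
  have h3 := pow_add_le_prod_add hn hq hrpos (by positivity) hk.le h2 hrprod.ge
  simp only [sub_add_cancel] at h3
  have h4 : (c * a₂ + k) ^ n ≤ (c * a₁) ^ n := by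
    calc (c * a₂ + k) ^ n ≤ ∏ i, p i := h3
      _ = ∏ i, max (p i) 0 := Finset.prod_congr rfl fun i _ =>
          (max_eq_left (by linarith [hq i, hrpos i])).symm
      _ = c ^ n * ((∏ i, l i) * ∏ i, max (p i) 0) := by rw [← mul_assoc, hcl, one_mul]
      _ ≤ c ^ n * a₁ ^ n := by gcongr
      _ = (c * a₁) ^ n := (mul_pow _ _ _).symm
  exact le_of_pow_le_pow_left₀ (by omega) (by positivity) h4

/-- Comparison of a subsolution with a rescaled nondecreasing supersolution. -/
theorem IsViscositySubsolution.le_diagScale {n : ℕ} (hn : 1 ≤ n)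
    {f₁ f₂ w u g₁ g₂ : EuclideanSpace ℝ (Fin n) → ℝ} {l : Fin n → ℝ} {c k κ : ℝ}
    (hw : IsViscositySubsolution (rhsOriginal f₁) w)
    (hu : IsViscositySupersolution (rhsOriginal f₂) u) (hmono : NondecreasingOnCube u)
    (hf₁ : ∀ x ∈ unitCube n, f₁ x = g₁ x ^ n) (hf₂ : ∀ x ∈ unitCube n, f₂ x = g₂ x ^ n)
    (hg₁ : ∀ x ∈ unitCube n, 0 ≤ g₁ x) (hg₂ : ∀ x ∈ unitCube n, 0 ≤ g₂ x)
    (hg₂c : ContinuousOn g₂ (unitCube n))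
    (hl : ∀ i, 0 < l i ∧ l i ≤ 1) (hc : 0 < c) (hcl : c ^ n * ∏ i, l i = 1) (hκ : 0 ≤ κ)
    (hk : c * κ < k) (hg : ∀ x ∈ unitCube n, g₁ x ≤ g₂ (diagScale l x) + κ)
    {x₀ : EuclideanSpace ℝ (Fin n)} (hx₀ : x₀ ∈ unitCube n) :
    w x₀ ≤ c * u (diagScale l x₀) + k * (n * geomMean (diagScale l x₀)) := by
  by_contra! hlt
  have hk0 : 0 < k := (mul_nonneg hc.le hκ).trans_lt hk
  have hu0 : ∀ y ∈ unitCube n, 0 ≤ u y := fun y hy => hu.nonneg_of_nondecreasing hn hmono hy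
  have hgm0 : ∀ y ∈ unitCube n, 0 ≤ geomMean y := fun y hy => geomMean_nonneg fun i => (hy i).1
  have hcpt := isCompact_unitCube n
  set m := w x₀ - c * u (diagScale l x₀) - k * (n * geomMean (diagScale l x₀)) with hm
  have hm0 : 0 < m := by linarith
  have hσ₀ := diagScale_mem_unitCube hl hx₀
  have hwx₀ : m ≤ w x₀ := by
    have h1 := mul_nonneg hc.le (hu0 _ hσ₀)
    have h2 := mul_nonneg hk0.le (mul_nonneg (Nat.cast_nonneg n) (hgm0 _ hσ₀))
    linarith
  -- an upper bound for `w`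
  obtain ⟨xB, hxB, hB⟩ := hw.usc.exists_isMaxOn ⟨x₀, hx₀⟩ hcpt
  have hB0 : 0 < w xB := hm0.trans_le (hwx₀.trans (hB hx₀))
  -- the points where `w` is at least `m` stay away from the boundary
  obtain ⟨ρ, hρ0, hρ⟩ : ∃ ρ > 0, ∀ x ∈ unitCube n, m ≤ w x → ∀ i, ρ ≤ l i * x i := by
    have hA : IsCompact (unitCube n ∩ w ⁻¹' Set.Ici m) :=
      hw.usc.isCompact_inter_preimage_Ici hcpt m
    have hcont : Continuous (fun x : EuclideanSpace ℝ (Fin n) => ∏ i, l i * x i) := by fun_prop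
    obtain ⟨z, hz, hzmin⟩ := hA.exists_isMinOn ⟨x₀, hx₀, hwx₀⟩ hcont.continuousOn
    have hpos : ∀ i, 0 < z i := by
      intro i
      refine lt_of_le_of_ne (hz.1 i).1 fun h => ?_
      have h1 := hw.boundary z (mem_lowerBoundary_of_eq_zero hz.1 i h.symm)
      have h2 : m ≤ w z := hz.2
      linarith
    refine ⟨∏ i, l i * z i, Finset.prod_pos fun i _ => mul_pos (hl i).1 (hpos i), ?_⟩
    intro x hx hwx i
    refine (hzmin ⟨hx, hwx⟩).trans ?_
    have hσ := diagScale_mem_unitCube hl hx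
    change ∏ i, l i * x i ≤ _
    rw [← Finset.mul_prod_erase _ _ (Finset.mem_univ i)]
    exact mul_le_of_le_one_right (hσ i).1 (Finset.prod_le_one (fun j _ => (hσ j).1)
      fun j _ => (hσ j).2)
  -- uniform continuity of `g₂`
  have hε : 0 < k / c - κ := by
    rw [sub_pos, lt_div_iff₀ hc]
    linarith
  obtain ⟨δ, hδ0, hδ⟩ := Metric.uniformContinuousOn_iff.1
    (hcpt.uniformContinuousOn_of_continuous hg₂c) (k / c - κ) hε
  -- Distance below ρ keeps y off the lower boundary; distance below δ controls the oscillation of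
  -- g₂.
  set η := min ρ δ with hη
  have hη0 : 0 < η := lt_min hρ0 hδ0
  -- At the maximum the penalty is less than max w, so this N forces the sum of squares below η².
  set N := 2 * w xB / η ^ 2 with hN
  have hN0 : 0 < N := by positivity
  -- the doubled function attains its maximum
  have husc : UpperSemicontinuousOn (fun p : EuclideanSpace ℝ (Fin n) × EuclideanSpace ℝ (Fin n) =>
      w p.1 + (-(c * u p.2) + (-(k * (n * geomMean p.2)) -
        N / 2 * ∑ i, (l i * p.1 i - p.2 i) ^ 2))) (unitCube n ×ˢ unitCube n) := by
    refine UpperSemicontinuousOn.add ?_ (UpperSemicontinuousOn.add ?_ ?_)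
    · exact hw.usc.comp continuous_fst.continuousOn fun p hp => hp.1
    · have h1 : LowerSemicontinuousOn (fun p : EuclideanSpace ℝ (Fin n) ×
          EuclideanSpace ℝ (Fin n) => u p.2) (unitCube n ×ˢ unitCube n) :=
        hu.lsc.comp continuous_snd.continuousOn fun p hp => hp.2
      exact (by fun_prop : Continuous fun t : ℝ => -(c * t)).comp_lowerSemicontinuousOn_antitone h1
        fun a b hab => by
          have := mul_le_mul_of_nonneg_left hab hc.le
          change -(c * b) ≤ -(c * a)
          linarith
    · have := continuous_geomMean n
      exact Continuous.upperSemicontinuous (by fun_prop) |>.upperSemicontinuousOn _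
  obtain ⟨⟨x, y⟩, ⟨hx, hy⟩, hmax⟩ := husc.exists_isMaxOn ⟨(x₀, x₀), Set.mk_mem_prod hx₀ hx₀⟩ (hcpt.prod hcpt)
  simp only at hx hy
  have hmax' : ∀ x' ∈ unitCube n, ∀ y' ∈ unitCube n,
      w x' - c * u y' - k * (n * geomMean y') - N / 2 * ∑ i, (l i * x' i - y' i) ^ 2 ≤
        w x - c * u y - k * (n * geomMean y) - N / 2 * ∑ i, (l i * x i - y i) ^ 2 := by
    intro x' hx' y' hy'
    have := isMaxOn_iff.1 hmax (x', y') (Set.mk_mem_prod hx' hy')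
    simp only at this
    linarith
  have hΦ := hmax' x₀ hx₀ _ hσ₀
  simp only [diagScale_apply, sub_self, ne_eq, OfNat.ofNat_ne_zero, not_false_eq_true, zero_pow,
    Finset.sum_const_zero, mul_zero, sub_zero] at hΦ
  have e1 := mul_nonneg hc.le (hu0 _ hy)
  have e2 := mul_nonneg hk0.le (mul_nonneg (Nat.cast_nonneg n) (hgm0 _ hy))
  have e3 : 0 ≤ ∑ i, (l i * x i - y i) ^ 2 := Finset.sum_nonneg fun i _ => sq_nonneg _
  have e4 : 0 ≤ N / 2 * ∑ i, (l i * x i - y i) ^ 2 := by positivity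
  have hwx : m ≤ w x := by linarith
  have hwB : w x ≤ w xB := hB hx
  have hdist : ∑ i, (l i * x i - y i) ^ 2 < η ^ 2 := by
    have h1 : N / 2 * ∑ i, (l i * x i - y i) ^ 2 < w xB := by linarith
    have h2 : N / 2 = w xB / η ^ 2 := by
      rw [hN]
      ring
    rw [h2, div_mul_eq_mul_div, div_lt_iff₀ (by positivity)] at h1
    exact lt_of_mul_lt_mul_left h1 hB0.le
  have hxpos : ∀ i, 0 < x i := fun i =>
    (pos_iff_pos_of_mul_pos (hρ0.trans_le (hρ x hx hwx i))).1 (hl i).1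
  have hypos : ∀ i, 0 < y i := by
    intro i
    have h1 : (l i * x i - y i) ^ 2 < η ^ 2 :=
      (Finset.single_le_sum (f := fun i => (l i * x i - y i) ^ 2) (fun j _ => sq_nonneg _)
        (Finset.mem_univ i)).trans_lt hdist
    have h2 := (abs_lt_of_sq_lt_sq' h1 hη0.le).2
    linarith [hρ x hx hwx i, min_le_left ρ δ]
  have hσ := diagScale_mem_unitCube hl hx
  have hd : dist (diagScale l x) y < δ := by
    rw [EuclideanSpace.dist_eq, Real.sqrt_lt' hδ0]
    simp only [diagScale_apply, Real.dist_eq, sq_abs]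
    exact hdist.trans_le (pow_le_pow_left₀ hη0.le (min_le_right _ _) 2)
  have hgg := (abs_lt.1 (Real.dist_eq _ _ ▸ hδ _ hσ _ hy hd)).2
  have hfin := le_of_isMaxOn_doubled hn hw hu hmono (fun i => (hl i).1) hc hcl hk0
    (mem_halfOpenCube_of_mem_unitCube hx hxpos) (mem_halfOpenCube_of_mem_unitCube hy hypos)
    (fun x' hx' y' hy' => hmax' x' (halfOpenCube_subset_unitCube n hx') y'
      (halfOpenCube_subset_unitCube n hy')) (hg₁ x hx) (hg₂ y hy) (hf₁ x hx) (hf₂ y hy)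
  -- Contradiction: g₁ x ≤ g₂(σx) + κ < g₂ y + k/c by the choice of δ.
  have h5 : g₂ y + k / c ≤ g₁ x := by
    rw [← mul_le_mul_iff_right₀ hc, mul_add, mul_div_cancel₀ _ hc.ne']
    exact hfin
  linarith [hg x hx]

/-! ### Consequences of the comparison. -/

/-- The comparison needs strict room k > cκ; this is the passage to the limit k = cκ. -/
theorem le_add_mul_of_forall_gt {a b d k₀ : ℝ} (h : ∀ k, k₀ < k → a ≤ b + k * d) :
    a ≤ b + k₀ * d := by
  have hc : Continuous fun k : ℝ => b + k * d := by fun_prop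
  refine ge_of_tendsto ((hc.tendsto k₀).mono_left (nhdsWithin_le_nhds (s := Set.Ioi k₀))) ?_
  filter_upwards [self_mem_nhdsWithin] with k hk using h k hk

theorem isViscositySupersolution_zero (n : ℕ) :
    IsViscositySupersolution (n := n) (rhsOriginal fun _ => 0) fun _ => 0 where
  lsc := lowerSemicontinuousOn_const
  boundary _ _ := le_rfl
  test φ _ x _ _ := posPartialProd_nonneg φ x

theorem diagScale_one {n : ℕ} (x : EuclideanSpace ℝ (Fin n)) : diagScale (fun _ => 1) x = x := by
  ext i
  simp

/-- The explicit solution with constant right-hand side dominates subsolutions. -/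
theorem IsViscositySubsolution.le_geomMean {n : ℕ} (hn : 1 ≤ n)
    {f w g : EuclideanSpace ℝ (Fin n) → ℝ} {M : ℝ}
    (hw : IsViscositySubsolution (rhsOriginal f) w)
    (hf : ∀ x ∈ unitCube n, f x = g x ^ n) (hg : ∀ x ∈ unitCube n, 0 ≤ g x)
    (hM : ∀ x ∈ unitCube n, g x ≤ M) {x : EuclideanSpace ℝ (Fin n)} (hx : x ∈ unitCube n) :
    w x ≤ M * (n * geomMean x) := by
  have h := le_add_mul_of_forall_gt (a := w x) (b := 0) (d := n * geomMean x) (k₀ := M) ?_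
  · simpa using h
  · intro k hk
    -- Against the zero supersolution the whole right-hand side is charged to κ = M, and only the
    -- term k n `geomMean` remains.
    have h0 := hw.le_diagScale (g₁ := g) (g₂ := fun _ => 0) (l := fun _ => 1) (c := 1) (κ := M)
      hn (isViscositySupersolution_zero n) (fun _ _ _ _ _ => le_rfl) hf
      (fun _ _ => (zero_pow (by omega)).symm) hg (fun _ _ => le_rfl) continuousOn_const
      (fun _ => ⟨one_pos, le_rfl⟩) one_pos (by simp) ((hg x hx).trans (hM x hx)) (by simpa using hk)
      (fun y hy => by simpa using hM y hy) hx
    simpa [diagScale_one] using h0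

/-- The unscaled case l = 1, κ = 0, with k tending to 0. It yields maximality. -/
theorem IsViscositySubsolution.le_supersolution {n : ℕ} (hn : 1 ≤ n)
    {f w u g : EuclideanSpace ℝ (Fin n) → ℝ}
    (hw : IsViscositySubsolution (rhsOriginal f) w)
    (hu : IsViscositySupersolution (rhsOriginal f) u) (hmono : NondecreasingOnCube u)
    (hf : ∀ x ∈ unitCube n, f x = g x ^ n) (hg : ∀ x ∈ unitCube n, 0 ≤ g x)
    (hgc : ContinuousOn g (unitCube n)) {x : EuclideanSpace ℝ (Fin n)} (hx : x ∈ unitCube n) :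
    w x ≤ u x := by
  have h := le_add_mul_of_forall_gt (a := w x) (b := u x) (d := n * geomMean x) (k₀ := 0) ?_
  · simpa using h
  · intro k hk
    have h0 := hw.le_diagScale (l := fun _ => 1) (c := 1) (κ := 0) hn hu hmono hf hf hg hg hgc
      (fun _ => ⟨one_pos, le_rfl⟩) one_pos (by simp) le_rfl (by simpa using hk)
      (fun y hy => by simp [diagScale_one]) hx
    simpa [diagScale_one] using h0

/-! ### The one-sided Lipschitz estimate. -/

theorem EuclideanSpace.norm_sub_diagScale_le {n : ℕ} {l : Fin n → ℝ}
    (hl : ∀ i, 0 < l i ∧ l i ≤ 1) {x : EuclideanSpace ℝ (Fin n)} (hx : x ∈ unitCube n) :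
    ‖x - diagScale l x‖ ≤ ∑ i, (1 - l i) := by
  have h0 : ∀ i, 0 ≤ 1 - l i := fun i => sub_nonneg.2 (hl i).2
  rw [EuclideanSpace.norm_eq]
  refine Real.sqrt_le_iff.2 ⟨Finset.sum_nonneg fun i _ => h0 i, ?_⟩
  refine le_trans (Finset.sum_le_sum (g := fun i => (1 - l i) ^ 2) fun i _ => ?_)
    (Finset.sum_sq_le_sq_sum_of_nonneg fun i _ => h0 i)
  have h1 : (x - diagScale l x) i = (1 - l i) * x i := by
    simp only [PiLp.sub_apply, diagScale_apply]
    ring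
  rw [h1, Real.norm_eq_abs, sq_abs]
  have h2 := mul_le_of_le_one_right (h0 i) (hx i).2
  exact pow_le_pow_left₀ (mul_nonneg (h0 i) (hx i).1) h2 2

/-- Convexity of t^n on [0,∞): the graph lies above its tangent at a. -/
theorem pow_sub_pow_le_mul {n : ℕ} (hn : 1 ≤ n) {a b : ℝ} (ha : 0 ≤ a) (hb : 0 ≤ b) :
    a ^ n - b ^ n ≤ n * a ^ (n - 1) * (a - b) := by
  induction n, hn using Nat.le_induction with
  | base => simp
  | succ n hn ih =>
    have h1 : 0 ≤ (a - b) * (a ^ n - b ^ n) := by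
      rcases le_total a b with h | h
      · exact mul_nonneg_of_nonpos_of_nonpos (sub_nonpos.2 h)
          (sub_nonpos.2 (pow_le_pow_left₀ ha h n))
      · exact mul_nonneg (sub_nonneg.2 h) (sub_nonneg.2 (pow_le_pow_left₀ hb h n))
    have h2 := mul_le_mul_of_nonneg_left ih ha
    have h3 : a * (n * a ^ (n - 1) * (a - b)) = n * a ^ n * (a - b) := by
      rw [← pow_sub_one_mul (show n ≠ 0 by omega) a]
      ring
    rw [h3] at h2
    push_cast
    rw [pow_succ, pow_succ]
    linarith

/-- One-sided Lipschitz estimate for `(u / n)^n` along increasing directions. -/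
theorem pow_div_sub_pow_div_le_of_le {n : ℕ} (hn : 1 ≤ n)
    {f u g : EuclideanSpace ℝ (Fin n) → ℝ} {M : ℝ} {K : NNReal}
    (hu : IsViscositySolution (rhsOriginal f) u) (hmono : NondecreasingOnCube u)
    (hf : ∀ x ∈ unitCube n, f x = g x ^ n) (hg : ∀ x ∈ unitCube n, 0 ≤ g x)
    (hM : ∀ x ∈ unitCube n, g x ≤ M) (hK : LipschitzOnWith K g (unitCube n))
    {x y : EuclideanSpace ℝ (Fin n)} (hx : x ∈ unitCube n) (hy : y ∈ unitCube n)
    (hyx : ∀ i, y i ≤ x i) :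
    (u x / n) ^ n - (u y / n) ^ n ≤ n * M ^ (n - 1) * (M + K) * ∑ i, (x i - y i) := by
  have hn0 : (0 : ℝ) < n := by exact_mod_cast hn
  have hn1 : (1 : ℝ) ≤ n := by exact_mod_cast hn
  have hsplit : ∀ a : ℝ, a ^ (n - 1) * a = a ^ n := fun a => pow_sub_one_mul (by omega) a
  have hM0 : 0 ≤ M := (hg x hx).trans (hM x hx)
  have hsum0 : 0 ≤ ∑ i, (x i - y i) := Finset.sum_nonneg fun i _ => sub_nonneg.2 (hyx i)
  have hux0 := hu.2.nonneg_of_nondecreasing hn hmono hx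
  have huy0 := hu.2.nonneg_of_nondecreasing hn hmono hy
  have hbound : ∀ z ∈ unitCube n, u z / n ≤ M * geomMean z := by
    intro z hz
    rw [div_le_iff₀ hn0]
    linarith [hu.1.le_geomMean hn hf hg hM hz]
  have hgx := geomMean_nonneg fun i => (hx i).1
  have hprod := prod_sub_prod_le_sum Finset.univ (fun i _ => (hy i).1) (fun i _ => hyx i)
    fun i _ => (hx i).2
  by_cases hpos : ∀ i, 0 < y i
  · -- interior case
    have hxpos : ∀ i, 0 < x i := fun i => (hpos i).trans_le (hyx i)
    -- The scaling that carries x to y; c below is then dictated by c^n ∏ l_i = 1.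
    set l : Fin n → ℝ := fun i => y i / x i with hldef
    have hl : ∀ i, 0 < l i ∧ l i ≤ 1 := fun i =>
      ⟨div_pos (hpos i) (hxpos i), (div_le_one (hxpos i)).2 (hyx i)⟩
    have hσ : diagScale l x = y := by
      ext i
      simp [hldef, (hxpos i).ne']
    have hP : 0 < geomMean y := geomMean_pos hpos
    have hPx : 0 < geomMean x := geomMean_pos hxpos
    set c := geomMean x / geomMean y with hcdef
    have hc : 0 < c := div_pos hPx hP
    have hcP : c * geomMean y = geomMean x := div_mul_cancel₀ _ hP.ne'
    have hcl : c ^ n * ∏ i, l i = 1 := by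
      rw [hcdef, hldef, div_pow, geomMean_pow hn fun i => (hx i).1, geomMean_pow hn fun i => (hy i).1,
        Finset.prod_div_distrib]
      have h1 := (Finset.prod_pos fun i (_ : i ∈ Finset.univ) => hpos i).ne'
      have h2 := (Finset.prod_pos fun i (_ : i ∈ Finset.univ) => hxpos i).ne'
      field_simp
    set D := ∑ i, (1 - l i) with hD
    have hD0 : 0 ≤ D := Finset.sum_nonneg fun i _ => sub_nonneg.2 (hl i).2
    -- The scaling moves every point of the cube by at most D, so g changes by at most κ = K D.
    have hmain : u x ≤ c * u y + c * (K * D) * (n * geomMean y) := by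
      refine le_add_mul_of_forall_gt fun k hk => ?_
      have h0 := hu.1.le_diagScale hn hu.2 hmono hf hf hg hg hK.continuousOn hl hc hcl
        (κ := K * D) (by positivity) hk (fun z hz => ?_) hx
      · rwa [hσ] at h0
      · have h1 := hK.le_add_mul hz (diagScale_mem_unitCube hl hz)
        rw [dist_eq_norm] at h1
        have h2 := mul_le_mul_of_nonneg_left (EuclideanSpace.norm_sub_diagScale_le hl hz) K.2
        exact h1.trans (add_le_add_right h2 _)
    -- the estimate for `u / n`
    have hDprod : D * ∏ i, x i ≤ ∑ i, (x i - y i) := by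
      rw [hD, Finset.sum_mul]
      refine Finset.sum_le_sum fun i _ => ?_
      have h1 : ∏ j, x j ≤ x i := by
        rw [← Finset.mul_prod_erase _ _ (Finset.mem_univ i)]
        exact mul_le_of_le_one_right (hx i).1 (Finset.prod_le_one (fun j _ => (hx j).1)
          fun j _ => (hx j).2)
      have h2 : (1 - l i) * x i = x i - y i := by
        have := (hxpos i).ne'
        simp only [hldef]
        field_simp
      rw [← h2]
      exact mul_le_mul_of_nonneg_left h1 (sub_nonneg.2 (hl i).2)
    have hPyx : geomMean y ≤ geomMean x := by
      refine Real.rpow_le_rpow (Finset.prod_nonneg fun i _ => (hy i).1) ?_ (by positivity)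
      exact Finset.prod_le_prod (fun i _ => (hy i).1) fun i _ => hyx i
    have hc1 : 1 ≤ c := (one_le_div hP).2 hPyx
    have hdiff : u x / n - u y / n ≤ (geomMean x - geomMean y) * M + K * D * geomMean x := by
      have h1 : u x / n ≤ c * (u y / n) + K * D * geomMean x := by
        rw [div_le_iff₀ hn0]
        refine hmain.trans (le_of_eq ?_)
        rw [← hcP]
        field_simp
      have h2 : (c - 1) * (u y / n) ≤ (c - 1) * (M * geomMean y) :=
        mul_le_mul_of_nonneg_left (hbound y hy) (by linarith)
      have h3 : (c - 1) * (M * geomMean y) = (geomMean x - geomMean y) * M := by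
        rw [← hcP]
        ring
      linarith
    have hA0 : 0 ≤ u x / n := by positivity
    have hpow : (u x / n) ^ n - (u y / n) ^ n ≤
        n * (u x / n) ^ (n - 1) * (u x / n - u y / n) :=
      pow_sub_pow_le_mul hn hA0 (by positivity)
    have hpowP : geomMean x ^ (n - 1) * (geomMean x - geomMean y) ≤ ∑ i, (x i - y i) := by
      refine le_trans ?_ hprod
      rw [← geomMean_pow hn fun i => (hx i).1, ← geomMean_pow hn fun i => (hy i).1]
      have h1 : geomMean y ^ n ≤ geomMean x ^ (n - 1) * geomMean y := by
        rw [← hsplit]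
        gcongr
      have h2 : geomMean x ^ n = geomMean x ^ (n - 1) * geomMean x :=
        (hsplit _).symm
      linarith
    -- The key cancellation: ∏ x_j absorbs each denominator in D = ∑ (x_i - y_i)/x_i. The power n -
    -- 1 comes from differentiating the n-th power.
    have hpowD : geomMean x ^ (n - 1) * (D * geomMean x) ≤ ∑ i, (x i - y i) := by
      refine le_trans (le_of_eq ?_) hDprod
      rw [← geomMean_pow hn fun i => (hx i).1]
      rw [← hsplit (geomMean x)]
      ring
    calc (u x / n) ^ n - (u y / n) ^ n
        ≤ n * (u x / n) ^ (n - 1) * (u x / n - u y / n) := hpow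
      _ ≤ n * (u x / n) ^ (n - 1) * ((geomMean x - geomMean y) * M + K * D * geomMean x) := by
          gcongr
      _ ≤ n * (M * geomMean x) ^ (n - 1) *
            ((geomMean x - geomMean y) * M + K * D * geomMean x) := by
          have h1 : 0 ≤ (geomMean x - geomMean y) * M + K * D * geomMean x := by
            have := mul_nonneg (sub_nonneg.2 hPyx) hM0
            positivity
          have h2 := hbound x hx
          gcongr
      _ = n * M ^ (n - 1) * (M * (geomMean x ^ (n - 1) * (geomMean x - geomMean y)) +
            K * (geomMean x ^ (n - 1) * (D * geomMean x))) := by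
          rw [mul_pow]
          ring
      _ ≤ n * M ^ (n - 1) * (M * ∑ i, (x i - y i) + K * ∑ i, (x i - y i)) := by
          gcongr
      _ = n * M ^ (n - 1) * (M + K) * ∑ i, (x i - y i) := by ring
  · -- `y` lies on the lower boundary
    push Not at hpos
    obtain ⟨i, hi⟩ := hpos
    have hyP : ∏ j, y j = 0 := Finset.prod_eq_zero (Finset.mem_univ i) (le_antisymm hi (hy i).1)
    rw [hyP, sub_zero] at hprod
    -- With some y_i = 0 no scaling reaches y, but the explicit bound on u suffices because ∏ y_j =
    -- 0.
    have h1 : (u x / n) ^ n ≤ M ^ n * ∑ i, (x i - y i) := by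
      calc (u x / n) ^ n ≤ (M * geomMean x) ^ n :=
            pow_le_pow_left₀ (by positivity) (hbound x hx) n
        _ = M ^ n * ∏ i, x i := by rw [mul_pow, geomMean_pow hn fun i => (hx i).1]
        _ ≤ M ^ n * ∑ i, (x i - y i) := by gcongr
    have h2 : M ^ n ≤ n * M ^ (n - 1) * (M + K) := by
      have h3 : M ^ n = M ^ (n - 1) * M := (hsplit M).symm
      have h4 : 0 ≤ M ^ (n - 1) := by positivity
      have h5 : 0 ≤ M ^ (n - 1) * K := by positivity
      nlinarith [mul_nonneg (sub_nonneg.2 hn1) (add_nonneg (mul_nonneg h4 hM0) h5)]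
    have h3 : 0 ≤ (u y / n) ^ n := by positivity
    have h4 := mul_le_mul_of_nonneg_right h2 hsum0
    linarith

/-! ### The change of unknown v = (u/n)^n. -/

theorem posPartialProd_eq_zero_of_eventually_le {n : ℕ} (hn : 1 ≤ n)
    {φ : EuclideanSpace ℝ (Fin n) → ℝ} {x : EuclideanSpace ℝ (Fin n)}
    (hφ : DifferentiableAt ℝ φ x) (hx : x ∈ halfOpenCube n)
    (h : ∀ᶠ y in 𝓝[halfOpenCube n] x, φ x ≤ φ y) : posPartialProd φ x = 0 := by
  refine posPartialProd_eq_zero ⟨0, hn⟩ ?_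
  have h1 := partialDeriv_nonneg_of_eventually hφ.neg hx ⟨0, hn⟩
    (h.mono fun y hy _ => neg_le_neg hy)
  rw [partialDeriv, hφ.hasFDerivAt.neg.fderiv] at h1
  simpa [partialDeriv] using h1

theorem contDiffAt_nat_mul_rpow {n : ℕ} {φ : EuclideanSpace ℝ (Fin n) → ℝ}
    {x : EuclideanSpace ℝ (Fin n)} {s : ℝ} (hφ : ContDiff ℝ 1 φ) (hs : 0 < φ x + s) :
    ContDiffAt ℝ 1 (fun y => n * (φ y + s) ^ (1 / (n : ℝ))) x :=
  contDiffAt_const.mul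
    (ContDiffAt.rpow_const_of_ne (hφ.contDiffAt.add contDiffAt_const) hs.ne')

/-- The derivative of n (t + s)^{1/n} at the point is a^{1-n}, and its n-th power cancels
(a^n)^{n-1}, which is the factor v^{n-1} of the transformed equation. -/
theorem pow_mul_posPartialProd_nat_mul_rpow {n : ℕ} (hn : 1 ≤ n)
    {φ : EuclideanSpace ℝ (Fin n) → ℝ} {x : EuclideanSpace ℝ (Fin n)} {s a : ℝ}
    (hφ : DifferentiableAt ℝ φ x) (ha : 0 < a) (hs : φ x + s = a ^ n) :
    (a ^ n) ^ (n - 1) * posPartialProd (fun y => n * (φ y + s) ^ (1 / (n : ℝ))) x =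
      posPartialProd φ x := by
  have hn0 : (n : ℝ) ≠ 0 := by positivity
  have hd : HasDerivAt (fun t : ℝ => n * (t + s) ^ (1 / (n : ℝ))) (a / a ^ n) (φ x) := by
    have h1 := ((((hasDerivAt_id (φ x)).add_const s).rpow_const (p := 1 / (n : ℝ))
      (Or.inl (by simp only [id, hs]; positivity))).const_mul (n : ℝ))
    refine h1.congr_deriv ?_
    simp only [id]
    rw [hs, Real.rpow_sub_one (by positivity), one_div, Real.pow_rpow_inv_natCast ha.le (by omega)]
    field_simp
  rw [posPartialProd_comp hφ hd (by positivity), ← mul_assoc]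
  have h2 : (a ^ n) ^ (n - 1) * (a / a ^ n) ^ n = 1 := by
    rw [← pow_mul, mul_comm n, pow_mul, ← mul_pow, mul_div_assoc', pow_sub_one_mul (by omega),
      div_self (by positivity), one_pow]
  rw [h2, one_mul]

/-- The transformed function `(u / n)^n` solves the transformed equation. -/
theorem IsViscositySolution.transformed {n : ℕ} (hn : 1 ≤ n)
    {f u v : EuclideanSpace ℝ (Fin n) → ℝ} (hu : IsViscositySolution (rhsOriginal f) u)
    (hmono : NondecreasingOnCube u) (hv : ∀ x ∈ unitCube n, v x = (u x / n) ^ n) :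
    IsViscositySolution (rhsTransformed f) v := by
  have hn0 : (0 : ℝ) < n := by exact_mod_cast hn
  have hu0 : ∀ x ∈ unitCube n, 0 ≤ u x := fun x hx => hu.2.nonneg_of_nondecreasing hn hmono hx
  have hsub := halfOpenCube_subset_unitCube n
  have huc : ContinuousOn u (unitCube n) :=
    continuousOn_iff_lower_upperSemicontinuousOn.2 ⟨hu.2.lsc, hu.1.usc⟩
  have hvc : ContinuousOn v (unitCube n) := ((huc.div_const _).pow n).congr hv
  have hvΓ : ∀ x ∈ lowerBoundary n, v x = 0 := fun x hx => by
    rw [hv x hx.1, le_antisymm (hu.1.boundary x hx) (hu.2.boundary x hx), zero_div,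
      zero_pow (by omega)]
  have hv0 : ∀ x ∈ unitCube n, 0 ≤ v x := fun x hx => by
    rw [hv x hx]
    exact pow_nonneg (div_nonneg (hu0 x hx) hn0.le) n
  have hroot : ∀ x ∈ unitCube n, u x = n * v x ^ (1 / (n : ℝ)) := fun x hx => by
    rw [hv x hx, one_div, Real.pow_rpow_inv_natCast (div_nonneg (hu0 x hx) hn0.le) (by omega),
      mul_div_cancel₀ _ hn0.ne']
  refine ⟨⟨hvc.upperSemicontinuousOn, fun x hx => (hvΓ x hx).le, ?_⟩,
    ⟨hvc.lowerSemicontinuousOn, fun x hx => (hvΓ x hx).ge, ?_⟩⟩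
  · intro φ hφ x hx hmax
    have hφd := (hφ.differentiable (by simp)) x
    rcases (hu0 x (hsub hx)).eq_or_lt with h0 | hpos
    · rcases hn.eq_or_lt with rfl | hn2
      · have hvu : ∀ y ∈ unitCube 1, v y = u y := fun y hy => by simp [hv y hy]
        have := hu.1.test φ hφ x hx (by
          filter_upwards [hmax, self_mem_nhdsWithin] with y hy hy'
          rwa [hvu y (hsub hy'), hvu x (hsub hx)] at hy)
        simpa [rhsTransformed, rhsOriginal] using this
      · have hvx : v x = 0 := by
          rw [hv x (hsub hx), ← h0, zero_div, zero_pow (by omega)]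
        rw [posPartialProd_eq_zero_of_eventually_le hn hφd hx, rhsTransformed, hvx,
          zero_pow (by omega), zero_mul]
        filter_upwards [hmax, self_mem_nhdsWithin] with y hy hy'
        have := hv0 y (hsub hy')
        linarith
    · have ha : 0 < u x / n := div_pos hpos hn0
      -- The shift makes the test function touch v at x, so its root touches u there.
      have hs : φ x + (v x - φ x) = (u x / n) ^ n := by rw [← hv x (hsub hx)]; ring
      have h1 := hu.1.test_of_contDiffAt
        (contDiffAt_nat_mul_rpow hφ (s := v x - φ x) (by rw [hs]; positivity)) hx (by
          filter_upwards [hmax, self_mem_nhdsWithin] with y hy hy'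
          have e1 : n * v y ^ (1 / (n : ℝ)) ≤ n * (φ y + (v x - φ x)) ^ (1 / (n : ℝ)) := by
            have := hv0 y (hsub hy')
            gcongr
            linarith
          rw [hroot y (hsub hy'), hroot x (hsub hx), add_sub_cancel]
          linarith)
      rw [← pow_mul_posPartialProd_nat_mul_rpow hn hφd ha hs, rhsTransformed, hv x (hsub hx)]
      exact mul_le_mul_of_nonneg_left (by rwa [hv x (hsub hx)] at h1) (by positivity)
  · intro φ hφ x hx hmin
    have hφd := (hφ.differentiable (by simp)) x
    rcases (hu0 x (hsub hx)).eq_or_lt with h0 | hpos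
    · rcases hn.eq_or_lt with rfl | hn2
      · have hvu : ∀ y ∈ unitCube 1, v y = u y := fun y hy => by simp [hv y hy]
        have := hu.2.test φ hφ x hx (by
          filter_upwards [hmin, self_mem_nhdsWithin] with y hy hy'
          rwa [hvu y (hsub hy'), hvu x (hsub hx)] at hy)
        simpa [rhsTransformed, rhsOriginal] using this
      · have hvx : v x = 0 := by
          rw [hv x (hsub hx), ← h0, zero_div, zero_pow (by omega)]
        rw [rhsTransformed, hvx, zero_pow (by omega), zero_mul]
        exact posPartialProd_nonneg φ x
    · have ha : 0 < u x / n := div_pos hpos hn0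
      have hs : φ x + (v x - φ x) = (u x / n) ^ n := by rw [← hv x (hsub hx)]; ring
      have hs0 : 0 < φ x + (v x - φ x) := by rw [hs]; positivity
      -- Here the shifted test function lies below v, so its positivity near x must be secured
      -- before roots are compared.
      have hev : ∀ᶠ y in 𝓝[halfOpenCube n] x, 0 < φ y + (v x - φ x) :=
        mem_nhdsWithin_of_mem_nhds
          ((hφ.continuous.add continuous_const).continuousAt.eventually (lt_mem_nhds hs0))
      have h1 := hu.2.test_of_contDiffAt (contDiffAt_nat_mul_rpow hφ (s := v x - φ x) hs0) hx (by
          filter_upwards [hmin, hev, self_mem_nhdsWithin] with y hy hy0 hy'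
          have e1 : n * (φ y + (v x - φ x)) ^ (1 / (n : ℝ)) ≤ n * v y ^ (1 / (n : ℝ)) := by
            gcongr
            linarith
          rw [hroot y (hsub hy'), hroot x (hsub hx), add_sub_cancel]
          linarith)
      rw [← pow_mul_posPartialProd_nat_mul_rpow hn hφd ha hs, rhsTransformed, hv x (hsub hx)]
      exact mul_le_mul_of_nonneg_left (by rwa [hv x (hsub hx)] at h1) (by positivity)

/-- Nonnegative subsolutions of the transformed equation yield subsolutions of the original one. -/
theorem IsViscositySubsolution.of_transformed {n : ℕ} (hn : 1 ≤ n)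
    {f z : EuclideanSpace ℝ (Fin n) → ℝ} (hf : ∀ x ∈ unitCube n, 0 ≤ f x)
    (hz : IsViscositySubsolution (rhsTransformed f) z) (hz0 : ∀ x ∈ unitCube n, 0 ≤ z x) :
    IsViscositySubsolution (rhsOriginal f) fun x => n * max (z x) 0 ^ (1 / (n : ℝ)) := by
  have hn0 : (0 : ℝ) < n := by exact_mod_cast hn
  have hsub := halfOpenCube_subset_unitCube n
  have hw0 : ∀ x, 0 ≤ n * max (z x) 0 ^ (1 / (n : ℝ)) := fun x =>
    mul_nonneg hn0.le (Real.rpow_nonneg (le_max_right _ _) _)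
  refine ⟨?_, fun x hx => ?_, fun φ hφ x hx hmax => ?_⟩
  · have hc : Continuous fun t : ℝ => n * max t 0 ^ (1 / (n : ℝ)) :=
      continuous_const.mul ((continuous_id.max continuous_const).rpow_const
        fun _ => Or.inr (by positivity))
    refine hc.comp_upperSemicontinuousOn hz.usc fun a b hab => ?_
    change n * max a 0 ^ (1 / (n : ℝ)) ≤ n * max b 0 ^ (1 / (n : ℝ))
    gcongr
  · rw [max_eq_right (hz.boundary x hx), Real.zero_rpow (by positivity), mul_zero]
  · have hφd := (hφ.differentiable (by simp)) x
    -- At a zero of z the n-th root has no derivative to use when n ≥ 2. There nonnegativity makes φ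
    -- locally minimal, so its product of positive parts vanishes.
    rcases (hz0 x (hsub hx)).eq_or_lt with h0 | hpos
    · rw [posPartialProd_eq_zero_of_eventually_le hn hφd hx]
      · exact hf x (hsub hx)
      · filter_upwards [hmax] with y hy
        rw [← h0, max_self, Real.zero_rpow (by positivity), mul_zero] at hy
        linarith [hw0 y]
    · set a := z x ^ (1 / (n : ℝ)) with ha_def
      have ha : 0 < a := Real.rpow_pos_of_pos hpos _
      have han : a ^ n = z x := by
        rw [ha_def, one_div, Real.rpow_inv_natCast_pow hpos.le (by omega)]
      -- Shifts φ to touch n z^{1/n} at x; then ((φ + s)/n)^n touches z from above.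
      set s := n * a - φ x with hs
      have hd : HasDerivAt (fun t : ℝ => ((t + s) / n) ^ n) (a ^ (n - 1)) (φ x) := by
        refine ((((hasDerivAt_id (φ x)).add_const s).div_const (n : ℝ)).fun_pow n).congr_deriv ?_
        simp only [id, hs, add_sub_cancel]
        field_simp
      have h1 := hz.test_of_contDiffAt (φ := fun y => ((φ y + s) / n) ^ n) (by fun_prop) hx (by
        filter_upwards [hmax, self_mem_nhdsWithin] with y hy hy'
        have e0 : (φ x + s) / n = a := by
          rw [hs]
          field_simp
          ring
        rw [e0, han, sub_self, sub_nonpos]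
        rw [max_eq_left (hz0 y (hsub hy')), max_eq_left hpos.le] at hy
        have e1 : z y ^ (1 / (n : ℝ)) ≤ (φ y + s) / n := by
          rw [le_div_iff₀ hn0]
          linarith
        have e2 := hz0 y (hsub hy')
        calc z y = (z y ^ (1 / (n : ℝ))) ^ n := by
              rw [one_div, Real.rpow_inv_natCast_pow e2 (by omega)]
          _ ≤ ((φ y + s) / n) ^ n := by gcongr)
      rw [posPartialProd_comp hφd hd (by positivity), ← pow_mul, mul_comm (n - 1), pow_mul, han,
        rhsTransformed] at h1
      exact le_of_mul_le_mul_left h1 (by positivity)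

/-! ### Norms and conclusion. -/

theorem IsLipschitzOn.abs_sub_le {n : ℕ} {g : EuclideanSpace ℝ (Fin n) → ℝ}
    {S : Set (EuclideanSpace ℝ (Fin n))} (hg : IsLipschitzOn g S) :
    ∀ x ∈ S, ∀ y ∈ S, |g x - g y| ≤ lipSeminorm g S * ‖x - y‖ := by
  obtain ⟨K, hK⟩ := hg
  intro x hx y hy
  rcases eq_or_ne x y with rfl | hxy
  · simp
  rw [← div_le_iff₀ (norm_pos_iff.2 (sub_ne_zero.2 hxy))]
  refine le_csSup ⟨K, ?_⟩ ⟨x, hx, y, hy, hxy, rfl⟩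
  rintro q ⟨a, ha, b, hb, hab, rfl⟩
  rw [div_le_iff₀ (norm_pos_iff.2 (sub_ne_zero.2 hab)), ← Real.dist_eq, ← dist_eq_norm]
  exact hK.dist_le_mul a ha b hb

theorem lipSeminorm_nonneg {n : ℕ} (g : EuclideanSpace ℝ (Fin n) → ℝ)
    (S : Set (EuclideanSpace ℝ (Fin n))) : 0 ≤ lipSeminorm g S := by
  refine Real.sSup_nonneg ?_
  rintro q ⟨a, _, b, _, _, rfl⟩
  positivity

theorem lipSeminorm_le {n : ℕ} {g : EuclideanSpace ℝ (Fin n) → ℝ}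
    {S : Set (EuclideanSpace ℝ (Fin n))} {L : ℝ} (hL : 0 ≤ L)
    (h : ∀ x ∈ S, ∀ y ∈ S, |g x - g y| ≤ L * ‖x - y‖) : lipSeminorm g S ≤ L := by
  refine Real.sSup_le ?_ hL
  rintro q ⟨a, ha, b, hb, hab, rfl⟩
  rw [div_le_iff₀ (norm_pos_iff.2 (sub_ne_zero.2 hab))]
  exact h a ha b hb

theorem ContinuousOn.abs_le_supNormOn {n : ℕ} {g : EuclideanSpace ℝ (Fin n) → ℝ}
    (hg : ContinuousOn g (unitCube n)) {x : EuclideanSpace ℝ (Fin n)} (hx : x ∈ unitCube n) :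
    |g x| ≤ supNormOn g (unitCube n) :=
  le_csSup ((isCompact_unitCube n).bddAbove_image hg.abs) ⟨x, hx, rfl⟩

/-- Lipschitz estimate for `(u / n)^n`. -/
theorem abs_pow_div_sub_pow_div_le {n : ℕ} (hn : 1 ≤ n)
    {f u g : EuclideanSpace ℝ (Fin n) → ℝ} {M : ℝ} {K : NNReal}
    (hu : IsViscositySolution (rhsOriginal f) u) (hmono : NondecreasingOnCube u)
    (hf : ∀ x ∈ unitCube n, f x = g x ^ n) (hg : ∀ x ∈ unitCube n, 0 ≤ g x)
    (hM : ∀ x ∈ unitCube n, g x ≤ M) (hK : LipschitzOnWith K g (unitCube n))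
    {x y : EuclideanSpace ℝ (Fin n)} (hx : x ∈ unitCube n) (hy : y ∈ unitCube n) :
    |(u x / n) ^ n - (u y / n) ^ n| ≤ n ^ 2 * M ^ (n - 1) * (M + K) * ‖x - y‖ := by
  have hM0 : 0 ≤ M := (hg x hx).trans (hM x hx)
  have key : ∀ a ∈ unitCube n, ∀ b ∈ unitCube n,
      (u a / n) ^ n - (u b / n) ^ n ≤ n ^ 2 * M ^ (n - 1) * (M + K) * ‖a - b‖ := by
    intro a ha b hb
    -- The coordinatewise minimum reduces to comparable points: a to c by the one-sided estimate, c
    -- to b by monotonicity.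
    set c : EuclideanSpace ℝ (Fin n) := WithLp.toLp 2 fun i => min (a i) (b i) with hc
    have hcm : c ∈ unitCube n := fun i =>
      ⟨le_min (ha i).1 (hb i).1, (min_le_left _ _).trans (ha i).2⟩
    have h1 := pow_div_sub_pow_div_le_of_le hn hu hmono hf hg hM hK ha hcm fun i => min_le_left _ _
    have h2 : (u c / n) ^ n ≤ (u b / n) ^ n := by
      have h3 := hu.2.nonneg_of_nondecreasing hn hmono hcm
      have h4 := hmono c hcm b hb fun i => min_le_right _ _
      gcongr
    have h5 : ∑ i, (a i - c i) ≤ n * ‖a - b‖ := by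
      have h6 : ∀ i ∈ Finset.univ, a i - c i ≤ ‖a - b‖ := by
        intro i _
        have h7 := PiLp.norm_apply_le (a - b) i
        rw [PiLp.sub_apply, Real.norm_eq_abs] at h7
        refine le_trans ?_ h7
        change a i - min (a i) (b i) ≤ _
        rcases min_choice (a i) (b i) with h | h <;> rw [h]
        · simp
        · exact le_abs_self _
      simpa using Finset.sum_le_card_nsmul _ _ _ h6
    have h8 : n * M ^ (n - 1) * (M + K) * ∑ i, (a i - c i) ≤
        n * M ^ (n - 1) * (M + K) * (n * ‖a - b‖) :=
      mul_le_mul_of_nonneg_left h5 (by positivity)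
    linarith
  have h1 := key y hy x hx
  rw [norm_sub_rev] at h1
  exact abs_sub_le_iff.2 ⟨key x hx y hy, h1⟩

theorem mainTheorem9 (n : ℕ) (hn : 1 ≤ n) :
    ∃ C : ℝ, 0 < C ∧
      ∀ f : EuclideanSpace ℝ (Fin n) → ℝ,
        (∀ x ∈ unitCube n, 0 ≤ f x) →
        IsLipschitzOn (fun x => f x ^ (1 / (n : ℝ))) (unitCube n) →
        ∀ u v : EuclideanSpace ℝ (Fin n) → ℝ,
          IsViscositySolution (rhsOriginal f) u →
          NondecreasingOnCube u →
          (∀ x ∈ unitCube n, v x = u x ^ n / (n : ℝ) ^ n) →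
          (IsViscositySolution (rhsTransformed f) v ∧ NondecreasingOnCube v ∧
            ∀ z : EuclideanSpace ℝ (Fin n) → ℝ, IsViscositySubsolution (rhsTransformed f) z →
              (∀ x ∈ unitCube n, 0 ≤ z x) → ∀ x ∈ unitCube n, z x ≤ v x) ∧
          IsLipschitzOn v (unitCube n) ∧
          lipSeminorm v (unitCube n) ≤
            C * supNormOn (fun x => f x ^ (((n : ℝ) - 1) / (n : ℝ))) (unitCube n) *
              lipNorm (fun x => f x ^ (1 / (n : ℝ))) (unitCube n) := by
  have hn0 : (0 : ℝ) < n := by exact_mod_cast hn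
  -- One factor n comes from the n-th power, the other from bounding a sum of n coordinate
  -- differences by the Euclidean norm.
  refine ⟨(n : ℝ) ^ 2, by positivity, fun f hf0 hlip u v hu hmono hv' => ?_⟩
  have hv : ∀ x ∈ unitCube n, v x = (u x / n) ^ n := fun x hx => by rw [hv' x hx, div_pow]
  have hu0 : ∀ x ∈ unitCube n, 0 ≤ u x := fun x hx => hu.2.nonneg_of_nondecreasing hn hmono hx
  set g : EuclideanSpace ℝ (Fin n) → ℝ := fun x => f x ^ (1 / (n : ℝ)) with hg
  have hf : ∀ x ∈ unitCube n, f x = g x ^ n := fun x hx => by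
    rw [hg]
    simp only [one_div]
    rw [Real.rpow_inv_natCast_pow (hf0 x hx) (by omega)]
  have hg0 : ∀ x ∈ unitCube n, 0 ≤ g x := fun x hx => Real.rpow_nonneg (hf0 x hx) _
  have hgc : ContinuousOn g (unitCube n) := hlip.choose_spec.continuousOn
  have hzero : (0 : EuclideanSpace ℝ (Fin n)) ∈ unitCube n := (zero_mem_lowerBoundary hn).1
  obtain ⟨xM, hxM, hmaxM⟩ := (isCompact_unitCube n).exists_isMaxOn ⟨0, hzero⟩ hgc
  set K : NNReal := ⟨lipSeminorm g (unitCube n), lipSeminorm_nonneg _ _⟩ with hKdef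
  have hK : LipschitzOnWith K g (unitCube n) := LipschitzOnWith.of_dist_le_mul fun x hx y hy => by
    rw [Real.dist_eq, dist_eq_norm]
    exact hlip.abs_sub_le x hx y hy
  set S := supNormOn (fun x => f x ^ (((n : ℝ) - 1) / (n : ℝ))) (unitCube n) with hS
  -- For n = 1 both exponents are 0, and 0^0 = 1 gives the convention that this function is
  -- identically 1.
  have hpow : ∀ x ∈ unitCube n, f x ^ (((n : ℝ) - 1) / (n : ℝ)) = g x ^ (n - 1) := fun x hx => by
    rw [hg, ← Real.rpow_natCast, ← Real.rpow_mul (hf0 x hx), Nat.cast_sub hn, Nat.cast_one]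
    congr 1
    ring
  have hMS : g xM ^ (n - 1) ≤ S := by
    have h1 := ContinuousOn.abs_le_supNormOn ((hgc.pow (n - 1)).congr hpow) hxM
    rw [hpow xM hxM] at h1
    exact (le_abs_self _).trans h1
  have hMN : g xM + K ≤ lipNorm g (unitCube n) :=
    add_le_add ((le_abs_self _).trans (hgc.abs_le_supNormOn hxM)) le_rfl
  have hgM := hg0 xM hxM
  have hN0 : 0 ≤ lipNorm g (unitCube n) := (add_nonneg hgM K.2).trans hMN
  have hS0 : 0 ≤ S := (pow_nonneg hgM _).trans hMS
  have hest : ∀ x ∈ unitCube n, ∀ y ∈ unitCube n,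
      |v x - v y| ≤ n ^ 2 * S * lipNorm g (unitCube n) * ‖x - y‖ := by
    intro x hx y hy
    rw [hv x hx, hv y hy]
    refine (abs_pow_div_sub_pow_div_le hn hu hmono hf hg0 (fun z hz => hmaxM hz) hK hx hy).trans ?_
    gcongr
  refine ⟨⟨hu.transformed hn hmono hv, fun x hx y hy hxy => ?_, fun z hz hz0 x hx => ?_⟩, ?_, ?_⟩
  · rw [hv x hx, hv y hy]
    have h1 := hu0 x hx
    have h2 := hmono x hx y hy hxy
    gcongr
  · have h1 := (hz.of_transformed hn hf0 hz0).le_supersolution hn hu.2 hmono hf hg0 hgc hx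
    rw [max_eq_left (hz0 x hx)] at h1
    have h2 : z x ^ (1 / (n : ℝ)) ≤ u x / n := by
      rw [le_div_iff₀ hn0]
      linarith
    rw [hv x hx]
    have h3 := Real.rpow_nonneg (hz0 x hx) (1 / (n : ℝ))
    calc z x = (z x ^ (1 / (n : ℝ))) ^ n := by
          rw [one_div, Real.rpow_inv_natCast_pow (hz0 x hx) (by omega)]
      _ ≤ (u x / n) ^ n := by gcongr
  · refine ⟨⟨n ^ 2 * S * lipNorm g (unitCube n), by positivity⟩,
      LipschitzOnWith.of_dist_le_mul fun x hx y hy => ?_⟩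
    rw [Real.dist_eq, dist_eq_norm]
    exact hest x hx y hy
  · exact lipSeminorm_le (by positivity) hest
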